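/- Let $T\ge 1$, $\mu_0\in\mathbb R^T$ and $\Sigma_0\in\mathbb R^{T\times T}$ with $\Sigma_0$ invertible, and let $(X_t)_{t\ge 1}$ be an infinite sequence of real-valued random variables. For $n\ge 1$ write $n=KT+\tau_0$ with $K\ge 0$ and $1\le \tau_0\le T$. We say that $X_1,\dots,X_n$ is a $T$-long episodic signal with parameters $(\mu_0,\Sigma_0)$ if the joint law of the $K$ full episodes $(X_{kT+1},\dots,X_{kT+T})$, $0\le k<K$, and of the last episode $(X_{KT+1},\dots,X_{KT+\tau_0})$ is the product of $K$ copies of the law of $(X_1,\dots,X_T)$ and of the law of $(X_1,\dots,X_{\tau_0})$, and if $X_1,\dots,X_T$ are square-integrable with mean vector $\mu_0$ and covariance matrix $\Sigma_0$. (Independence, identical distribution or normality within an episode is not assumed.) Rolling setup. Under the null hypothesis $H_0$, for every $n\ge 1$ the variables $X_1,\dots,X_n$ form a $T$-long episodic signal with parameters $(\mu_0,\Sigma_0)$. For $\epsilon>0$, under the alternative $H_A^\epsilon$, for every $K\ge 1$ the variables $X_1,\dots,X_{KT}$ form a $T$-long episodic signal with parameters $(\mu_0-\epsilon\mathbf 1,\Sigma_0)$,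 where $\mathbf 1=(1,\dots,1)^\top$. Statistics. Put $s_{simp}(x_1,\dots,x_n)=\sum_{t=1}^n x_t$ and $s_{unif}(x_1,\dots,x_n)=\mathbf 1^\top\Sigma^{-1}x$, where $\Sigma\in\mathbb R^{n\times n}$ is block-diagonal with blocks $\Sigma_0$ (the last block being the upper-left $\tau_0\times\tau_0$ block of $\Sigma_0$). For $s\in\{s_{simp},s_{unif}\}$ and $K\ge 1$ define $$\tilde s^K=\frac{s(X_1,\dots,X_{KT})-K\,E[s(X_1,\dots,X_T)\mid H_0]}{\sqrt{K\,\mathrm{Var}(s(X_1,\dots,X_T)\mid H_0)}} .$$ Let $\alpha\in(0,1)$ and let $q_\alpha^0$ be the $\alpha$-quantile of the standard normal distribution. Then, for both $\tilde s^K=\tilde s^K_{simp}$ and $\tilde s^K=\tilde s^K_{unif}$, $$\lim_{K\to\infty}P\left(\tilde s^K\le q_\alpha^0\mid H_0\right)=\alpha,$$ and, for every $\epsilon>0$, $$\lim_{K\to\infty}P\left(\tilde s^K\le q_\alpha^0\mid H_A^\epsilon\right)=1 .$$ -/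

import Mathlib

open MeasureTheory ProbabilityTheory Filter Topology
open scoped Matrix

noncomputable section

namespace Episodic

variable {Ω : Type*} [MeasurableSpace Ω]

/-- The `l` consecutive observations of the signal that start at time index `s`.
Time is indexed from `0`: the first observation of the signal is `X 0`. -/
def segment (X : ℕ → Ω → ℝ) (s l : ℕ) (ω : Ω) : Fin l → ℝ := fun i => X (s + i) ω

/-- `K`, where a signal of length `n ≥ 1` is decomposed as `n = K * T + τ₀` with `1 ≤ τ₀ ≤ T`. -/
def fullEpisodes (n T : ℕ) : ℕ := (n - 1) / T

/-- `τ₀ ∈ {1, …, T}`, the length of the last (possibly partial) episode. -/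
def tailLength (n T : ℕ) : ℕ := n - fullEpisodes n T * T

/-- Under the law `P`, the first `n` variables of `X` form a `T`-long episodic signal with
parameters `μ₀` and `S₀` (the mean vector and the covariance matrix of one episode).

`joint_law` is the factorization of the joint distribution
`f (x₁, …, xₙ) = (∏_{k < K} f_{X₁, …, X_T} (x_{kT+1}, …, x_{kT+T})) * f_{X₁, …, X_τ₀} (x_{KT+1}, …, xₙ)`,
written for laws instead of densities, so that no density needs to exist. -/
structure IsEpisodicSignal (T n : ℕ) (μ₀ : Fin T → ℝ) (S₀ : Matrix (Fin T) (Fin T) ℝ)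
    (X : ℕ → Ω → ℝ) (P : Measure Ω) : Prop where
  measurable : ∀ t < n, Measurable (X t)
  joint_law :
    P.map (fun ω => ((fun k : Fin (fullEpisodes n T) => segment X (k * T) T ω),
        segment X (fullEpisodes n T * T) (tailLength n T) ω)) =
      (Measure.pi fun _ : Fin (fullEpisodes n T) => P.map (segment X 0 T)).prod
        (P.map (segment X 0 (tailLength n T)))
  memLp : ∀ i : Fin T, MemLp (X i) 2 P
  mean : ∀ i : Fin T, ∫ ω, X i ω ∂P = μ₀ i
  cov : ∀ i j : Fin T, covariance (X i) (X j) P = S₀ i j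

/-- The null hypothesis for the first `n` variables: an episodic signal with the known parameters
`T`, `μ₀`, `S₀`, where `S₀` is invertible. -/
def NullHypothesis (T : ℕ) (μ₀ : Fin T → ℝ) (S₀ : Matrix (Fin T) (Fin T) ℝ) (n : ℕ)
    (X : ℕ → Ω → ℝ) (P : Measure Ω) : Prop :=
  IsEpisodicSignal T n μ₀ S₀ X P ∧ IsUnit S₀

/-- The `E`-degradation hypothesis for the first `n` variables: for some `ε₀ ∈ E`, the signal is
episodic with the same `T` and `S₀` and with episode mean `μ₀ - ε₀`. -/
def DegradationHypothesis (T : ℕ) (μ₀ : Fin T → ℝ) (S₀ : Matrix (Fin T) (Fin T) ℝ)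
    (E : Set (Fin T → ℝ)) (n : ℕ) (X : ℕ → Ω → ℝ) (P : Measure Ω) : Prop :=
  ∃ ε₀ ∈ E, IsEpisodicSignal T n (μ₀ - ε₀) S₀ X P

/-- The rolling setup under the null hypothesis: an infinite sequence all of whose initial
segments satisfy the null hypothesis with the same parameters. -/
def RollingNull (T : ℕ) (μ₀ : Fin T → ℝ) (S₀ : Matrix (Fin T) (Fin T) ℝ)
    (X : ℕ → Ω → ℝ) (P : Measure Ω) : Prop :=
  ∀ n : ℕ, 1 ≤ n → NullHypothesis T μ₀ S₀ n X P

/-- The alternative of uniform degradation by `ε`: for every number `K ≥ 1` of episodes, the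
signal of length `K * T` satisfies the degradation hypothesis for the singleton `{ε • 1}`. -/
def RollingUniformDegradation (T : ℕ) (μ₀ : Fin T → ℝ) (S₀ : Matrix (Fin T) (Fin T) ℝ) (ε : ℝ)
    (X : ℕ → Ω → ℝ) (P : Measure Ω) : Prop :=
  ∀ K : ℕ, 1 ≤ K → DegradationHypothesis T μ₀ S₀ {fun _ => ε} (K * T) X P

/-- The covariance matrix of the first `n` variables of an episodic signal: block-diagonal with
blocks `S₀`, the last block cropped to its upper-left corner (`Fin.ofNat T s` is `s % T`). -/
def signalCov (T : ℕ) [NeZero T] (S₀ : Matrix (Fin T) (Fin T) ℝ) (n : ℕ) :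
    Matrix (Fin n) (Fin n) ℝ :=
  Matrix.of fun s t =>
    if (s : ℕ) / T = (t : ℕ) / T then S₀ (Fin.ofNat T s) (Fin.ofNat T t) else 0

/-- The simple sum of `n` observations. -/
def sSimp (n : ℕ) (x : Fin n → ℝ) : ℝ := ∑ t, x t

/-- The uniform-degradation weighted sum `W x`, where `W = 1ᵀ Σ⁻¹` and `Σ` is the covariance
matrix of the whole signal. -/
def sUnif (T : ℕ) [NeZero T] (S₀ : Matrix (Fin T) (Fin T) ℝ) (n : ℕ) (x : Fin n → ℝ) : ℝ :=
  ((fun _ => (1 : ℝ)) ᵥ* (signalCov T S₀ n)⁻¹) ⬝ᵥ x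

/-- The normalized statistic over `K` episodes: it is centred and scaled with the expectation and
the variance that the statistic of one episode has under the null law `P₀`. -/
def normalized (s : (n : ℕ) → (Fin n → ℝ) → ℝ) (T : ℕ) (X : ℕ → Ω → ℝ) (P₀ : Measure Ω)
    (K : ℕ) (ω : Ω) : ℝ :=
  (s (K * T) (segment X 0 (K * T) ω) - K * ∫ ω', s T (segment X 0 T ω') ∂P₀) /
    Real.sqrt (K * variance (fun ω' => s T (segment X 0 T ω')) P₀)

/-- The `α`-quantile of the standard normal distribution. -/
def normalQuantile (α : ℝ) : ℝ := sInf {x : ℝ | α ≤ cdf (gaussianReal 0 1) x}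

end Episodic

end

namespace Episodic

/-! ### The standard normal quantile -/

/-! On whole episodes `Σ` is block-diagonal with equal blocks `S₀`, so both statistics are sums over
episodes of one linear functional `w ⬝ᵥ episode`, with `w = 1` or `w = 1ᵀ S₀⁻¹` (`sSimp_segment`,
`sUnif_segment`). Episodes are i.i.d. (`iIndepFun_episodes`, `map_segment_eq`), so each statistic is
a random walk with square-integrable steps, whatever the dependence inside an episode.

The step variance `wᵀ S₀ w` is positive, because an invertible covariance matrix is positive
definite (`IsEpisodicSignal.posDef`). Under the null the central limit theorem gives level `α`.
Under the alternative the step mean drops by `ε (w ⬝ᵥ 1)`, where `w ⬝ᵥ 1` is `T` or `1ᵀ S₀⁻¹ 1`,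
positive in both cases; by the strong law the normalized walk behaves like a negative multiple of
`√K` and falls below any threshold. -/

lemma continuous_cdf {μ : Measure ℝ} [IsProbabilityMeasure μ] [NullSingletonClass μ] :
    Continuous (cdf μ) := by
  refine continuous_iff_continuousAt.2 fun x => ?_
  rw [(monotone_cdf μ).continuousAt_iff_leftLim_eq_rightLim, StieltjesFunction.rightLim_eq]
  have h : (cdf μ).measure {x} = 0 := by rw [measure_cdf]; exact measure_singleton x
  rw [StieltjesFunction.measure_singleton, ENNReal.ofReal_eq_zero] at h
  exact le_antisymm ((monotone_cdf μ).leftLim_le le_rfl) (by linarith)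

/-- By continuity the superlevel set is closed, so its infimum belongs to it, which gives `≥ α`; the
intermediate value theorem gives a point of value exactly `α`, which bounds the infimum from above.
-/
lemma cdf_normalQuantile {α : ℝ} (hα : α ∈ Set.Ioo (0 : ℝ) 1) :
    cdf (gaussianReal 0 1) (normalQuantile α) = α := by
  have : NullSingletonClass (gaussianReal 0 1) := nullSingletonClass_gaussianReal one_ne_zero
  set F := cdf (gaussianReal 0 1)
  have hF : Continuous F := continuous_cdf
  have hmono : Monotone F := monotone_cdf _
  obtain ⟨a, ha⟩ := ((tendsto_cdf_atBot (gaussianReal 0 1)).eventually_lt_const hα.1).exists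
  obtain ⟨b, hb⟩ := ((tendsto_cdf_atTop (gaussianReal 0 1)).eventually_const_lt hα.2).exists
  obtain ⟨x, hx⟩ := mem_range_of_exists_le_of_exists_ge hF ⟨a, ha.le⟩ ⟨b, hb.le⟩
  have hbdd : BddBelow {x : ℝ | α ≤ F x} :=
    ⟨a, fun y hy => le_of_not_gt fun hya => (hmono hya.le).not_gt (ha.trans_le hy)⟩
  have hmem : normalQuantile α ∈ {x : ℝ | α ≤ F x} :=
    (isClosed_le continuous_const hF).csInf_mem ⟨x, hx.ge⟩ hbdd
  exact le_antisymm ((hmono (csInf_le hbdd hx.ge)).trans hx.le) hmem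

/-! ### Limits of normalized sums of independent, identically distributed variables -/

section Limits

variable {Ω : Type*} [MeasurableSpace Ω] {P : Measure Ω} [IsProbabilityMeasure P]
  {Y : ℕ → Ω → ℝ}

/-- The central limit theorem, evaluated at a quantile of the standard normal distribution. -/
lemma tendsto_measureReal_normalized_sum_le_quantile (hindep : iIndepFun Y P)
    (hident : ∀ k, IdentDistrib (Y k) (Y 0) P P) (hL2 : MemLp (Y 0) 2 P)
    (hvar : 0 < variance (Y 0) P) {α : ℝ} (hα : α ∈ Set.Ioo (0 : ℝ) 1) :
    Tendsto (fun K : ℕ => P.real {ω | (∑ k ∈ Finset.range K, Y k ω - K * ∫ ω', Y 0 ω' ∂P) /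
      √(K * variance (Y 0) P) ≤ normalQuantile α}) atTop (𝓝 α) := by
  have : NullSingletonClass (gaussianReal 0 1) := nullSingletonClass_gaussianReal one_ne_zero
  set v := variance (Y 0) P with hv
  -- The limit `N(0, v)` is realized as `√v * x` under `N(0, 1)`, so that dividing by `√v` leaves
  -- the identity.
  have hZ : HasLaw (fun x : ℝ => √v * x) (gaussianReal 0 v.toNNReal) (gaussianReal 0 1) := by
    refine ⟨by fun_prop, ?_⟩
    rw [gaussianReal_map_const_mul]
    congr 1
    · simp
    · ext
      simp [Real.sq_sqrt hvar.le, hvar.le]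
  have h := (tendstoInDistribution_inv_sqrt_mul_sum_sub hZ hL2 hindep hident).continuous_comp
    (g := fun x => x / √v) (by fun_prop)
  -- Portmanteau: the frontier of the half-line is one point, which is Gaussian-null.
  have hlim := ProbabilityMeasure.tendsto_measure_of_null_frontier_of_tendsto' h.tendsto
    (E := Set.Iic (normalQuantile α))
  have hid : ((fun x : ℝ => x / √v) ∘ fun x => √v * x) = id := by
    ext x
    have : √v ≠ 0 := (Real.sqrt_pos.2 hvar).ne'
    simp [this]
  simp only [ProbabilityMeasure.coe_mk, hid, Measure.map_id, frontier_Iic] at hlim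
  have hlim' := (ENNReal.tendsto_toReal (measure_ne_top _ _)).comp (hlim (measure_singleton _))
  rw [← measureReal_def, ← cdf_eq_real, cdf_normalQuantile hα] at hlim'
  refine hlim'.congr fun K => ?_
  rw [Function.comp_apply, Measure.map_apply_of_aemeasurable (h.forall_aemeasurable K)
    measurableSet_Iic, measureReal_def]
  congr 2
  ext ω
  simp only [Set.mem_preimage, Function.comp_apply, Set.mem_Iic, Set.mem_ofPred_eq]
  rw [Real.sqrt_mul (by positivity), ← div_div, inv_mul_eq_div]

/-- If the centring exceeds the mean, then the normalized sums fall below every fixed threshold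
with probability tending to `1`. -/
lemma tendsto_measureReal_normalized_sum_le_one (hmeas : ∀ k, Measurable (Y k))
    (hindep : iIndepFun Y P)
    (hident : ∀ k, IdentDistrib (Y k) (Y 0) P P) (hL1 : Integrable (Y 0) P)
    {m v : ℝ} (hm : ∫ ω, Y 0 ω ∂P < m) (hv : 0 < v) (q : ℝ) :
    Tendsto (fun K : ℕ => P.real {ω | (∑ k ∈ Finset.range K, Y k ω - K * m) /
      √(K * v) ≤ q}) atTop (𝓝 1) := by
  have hslln := strong_law_ae_real Y hL1 (fun i j hij => hindep.indepFun hij) hident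
  have hae : ∀ᵐ ω ∂P, Tendsto (fun K : ℕ => (∑ k ∈ Finset.range K, Y k ω - K * m) / √(K * v))
      atTop atBot := by
    filter_upwards [hslln] with ω hω
    have hsqrt : Tendsto (fun K : ℕ => √(K : ℝ)) atTop atTop :=
      Real.tendsto_sqrt_atTop.comp tendsto_natCast_atTop_atTop
    -- For `K > 0` the normalized sum is `√K` times `(average - m) / √v`, and the second factor has
    -- a negative limit.
    have h := hsqrt.atTop_mul_neg (C := (∫ ω', Y 0 ω' ∂P - m) / √v)
      (div_neg_of_neg_of_pos (by linarith) (Real.sqrt_pos.2 hv))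
      ((hω.sub_const m).div_const (√v))
    refine h.congr' ?_
    filter_upwards [eventually_gt_atTop 0] with K hK
    have hK' : (0 : ℝ) < K := by exact_mod_cast hK
    have hsK : √(K : ℝ) ≠ 0 := (Real.sqrt_pos.2 hK').ne'
    have hsv : √v ≠ 0 := (Real.sqrt_pos.2 hv).ne'
    rw [Real.sqrt_mul hK'.le]
    field_simp
    rw [Real.sq_sqrt hK'.le]
  have hms : ∀ K : ℕ, MeasurableSet
      {ω | (∑ k ∈ Finset.range K, Y k ω - K * m) / √(K * v) ≤ q} := fun K =>
    measurableSet_le (((Finset.measurable_fun_sum _ fun k _ => hmeas k).sub_const _).div_const _)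
      measurable_const
  have h := tendsto_measure_of_ae_tendsto_indicator_of_isFiniteMeasure (μ := P) atTop
    (A := Set.univ) MeasurableSet.univ hms (by
      filter_upwards [hae] with ω hω
      filter_upwards [hω.eventually_le_atBot q] with K hK
      exact ⟨fun _ => Set.mem_univ _, fun _ => hK⟩)
  have h' := (ENNReal.tendsto_toReal (measure_ne_top P Set.univ)).comp h
  simpa only [measure_univ, ENNReal.toReal_one] using! h'

end Limits

/-! ### The episodes of a signal are independent and identically distributed -/

section Episodes

variable {Ω : Type*} [MeasurableSpace Ω] {X : ℕ → Ω → ℝ} {P : Measure Ω} {T : ℕ}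

/-- Since `1 ≤ τ₀ ≤ T`, a complete last episode counts as the tail, hence `K` and not `K + 1`. -/
lemma fullEpisodes_succ_mul (hT : 0 < T) (K : ℕ) : fullEpisodes ((K + 1) * T) T = K := by
  rw [fullEpisodes, Nat.div_eq_iff hT]
  have : (K + 1) * T = K * T + T := by ring
  omega

lemma measurable_segment (hX : ∀ t, Measurable (X t)) (s l : ℕ) :
    Measurable (segment X s l) :=
  measurable_pi_lambda _ fun _ => hX _

variable {μ : Fin T → ℝ} {S : Matrix (Fin T) (Fin T) ℝ}

lemma measurable_of_forall_isEpisodicSignal (hT : 0 < T)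
    (h : ∀ K, 1 ≤ K → IsEpisodicSignal T (K * T) μ S X P) (t : ℕ) : Measurable (X t) :=
  (h (t + 1) (by omega)).measurable t (by nlinarith)

variable [IsProbabilityMeasure P]

lemma map_episodes_eq_pi (hT : 0 < T)
    (h : ∀ K, 1 ≤ K → IsEpisodicSignal T (K * T) μ S X P) (K : ℕ) :
    P.map (fun ω (k : Fin K) => segment X (k * T) T ω) =
      Measure.pi fun _ : Fin K => P.map (segment X 0 T) := by
  have hX := measurable_of_forall_isEpisodicSignal hT h
  have hseg := fun s l => measurable_segment hX s l
  have hprob : ∀ l, IsProbabilityMeasure (P.map (segment X 0 l)) := fun l =>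
    Measure.isProbabilityMeasure_map (hseg 0 l).aemeasurable
  -- A signal of `K + 1` episodes is `K` full ones and a tail; the first marginal discards the tail.
  have hlaw := congrArg Measure.fst (h (K + 1) (by omega)).joint_law
  rw [Measure.fst_prod, Measure.fst_map_prodMk (hseg _ _), fullEpisodes_succ_mul hT] at hlaw
  exact hlaw

lemma map_segment_eq (hT : 0 < T)
    (h : ∀ K, 1 ≤ K → IsEpisodicSignal T (K * T) μ S X P) (k : ℕ) :
    P.map (segment X (k * T) T) = P.map (segment X 0 T) := by
  have hX := measurable_of_forall_isEpisodicSignal hT h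
  have hseg := fun s l => measurable_segment hX s l
  have hprob : IsProbabilityMeasure (P.map (segment X 0 T)) :=
    Measure.isProbabilityMeasure_map (hseg 0 T).aemeasurable
  have hlaw := congrArg (Measure.map (Function.eval (Fin.last k))) (map_episodes_eq_pi hT h (k + 1))
  rw [(measurePreserving_eval _ _).map_eq, Measure.map_map (measurable_pi_apply _)
    (measurable_pi_lambda _ fun _ => hseg _ _)] at hlaw
  exact hlaw

lemma iIndepFun_episodes (hT : 0 < T)
    (h : ∀ K, 1 ≤ K → IsEpisodicSignal T (K * T) μ S X P) :
    iIndepFun (fun k : ℕ => segment X (k * T) T) P := by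
  have hseg := fun s l => measurable_segment (measurable_of_forall_isEpisodicSignal hT h) s l
  have hfin : ∀ K : ℕ, iIndepFun (fun k : Fin K => segment X (k * T) T) P := fun K => by
    rw [iIndepFun_iff_map_fun_eq_pi_map fun k => (hseg _ _).aemeasurable, map_episodes_eq_pi hT h]
    simp_rw [map_segment_eq hT h]
  -- Independence concerns finite subfamilies, and each lies among the first `s.sup id + 1`
  -- episodes.
  rw [iIndepFun_iff_finset]
  intro s
  have hlt : ∀ i : s, (i : ℕ) < s.sup id + 1 := fun i =>
    Nat.lt_succ_of_le (Finset.le_sup (f := id) i.2)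
  exact (hfin (s.sup id + 1)).precomp (g := fun i : s => ⟨i, hlt i⟩)
    fun i j hij => Subtype.ext (Fin.mk.inj_iff.1 hij)

/-- Linear statistics of the episodes are independent. -/
lemma iIndepFun_dotProduct_episodes (hT : 0 < T)
    (h : ∀ K, 1 ≤ K → IsEpisodicSignal T (K * T) μ S X P) (w : Fin T → ℝ) :
    iIndepFun (fun (k : ℕ) ω => w ⬝ᵥ segment X (k * T) T ω) P :=
  (iIndepFun_episodes hT h).comp (fun _ x => w ⬝ᵥ x) fun _ => by
    unfold dotProduct
    fun_prop

/-- Linear statistics of the episodes are identically distributed. -/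
lemma identDistrib_dotProduct_episodes (hT : 0 < T)
    (h : ∀ K, 1 ≤ K → IsEpisodicSignal T (K * T) μ S X P) (w : Fin T → ℝ) (k : ℕ) :
    IdentDistrib (fun ω => w ⬝ᵥ segment X (k * T) T ω) (fun ω => w ⬝ᵥ segment X (0 * T) T ω)
      P P := by
  have hseg := fun s l => measurable_segment (measurable_of_forall_isEpisodicSignal hT h) s l
  have hid : IdentDistrib (segment X (k * T) T) (segment X (0 * T) T) P P :=
    ⟨(hseg _ _).aemeasurable, (hseg _ _).aemeasurable, by
      rw [map_segment_eq hT h, map_segment_eq hT h]⟩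
  exact hid.comp (u := fun x => w ⬝ᵥ x) (by unfold dotProduct; fun_prop)

end Episodes

/-! ### Moments of linear statistics of one episode -/

section Moments

variable {Ω : Type*} [MeasurableSpace Ω] {X : ℕ → Ω → ℝ} {P : Measure Ω} {T n : ℕ}
  {μ : Fin T → ℝ} {S : Matrix (Fin T) (Fin T) ℝ}

lemma dotProduct_segment_zero {Ω : Type*} {X : ℕ → Ω → ℝ} (w : Fin T → ℝ) (ω : Ω) :
    w ⬝ᵥ segment X 0 T ω = ∑ i, w i * X i ω := by
  simp [dotProduct, segment]

namespace IsEpisodicSignal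

lemma memLp_dotProduct (h : IsEpisodicSignal T n μ S X P) (w : Fin T → ℝ) :
    MemLp (fun ω => w ⬝ᵥ segment X 0 T ω) 2 P := by
  simp_rw [dotProduct_segment_zero]
  exact memLp_finsetSum _ fun i _ => (h.memLp i).const_mul (w i)

variable [IsProbabilityMeasure P]

lemma integral_dotProduct (h : IsEpisodicSignal T n μ S X P) (w : Fin T → ℝ) :
    ∫ ω, w ⬝ᵥ segment X 0 T ω ∂P = w ⬝ᵥ μ := by
  simp_rw [dotProduct_segment_zero]
  rw [integral_finsetSum _ fun i _ => ((h.memLp i).integrable (by norm_num)).const_mul (w i)]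
  simp_rw [integral_const_mul, h.mean]
  rfl

lemma variance_dotProduct (h : IsEpisodicSignal T n μ S X P) (w : Fin T → ℝ) :
    variance (fun ω => w ⬝ᵥ segment X 0 T ω) P = w ⬝ᵥ S *ᵥ w := by
  simp_rw [dotProduct_segment_zero]
  rw [variance_fun_sum fun i => (h.memLp i).const_mul (w i)]
  simp_rw [covariance_const_mul_left, covariance_const_mul_right, h.cov, dotProduct, Matrix.mulVec,
    dotProduct, Finset.mul_sum]
  exact Finset.sum_congr rfl fun i _ => Finset.sum_congr rfl fun j _ => by ring

/-- The quadratic form of `S` at `w` is a variance, so `S` is positive semidefinite; invertibility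
makes it definite. -/
lemma posDef (h : IsEpisodicSignal T n μ S X P) (hS : IsUnit S) : S.PosDef := by
  refine (Matrix.PosSemidef.posDef_iff_isUnit (.of_dotProduct_mulVec_nonneg ?_ fun w => ?_)).2 hS
  · ext i j
    simp only [Matrix.conjTranspose_apply, star_trivial, ← h.cov]
    exact covariance_comm _ _
  · rw [star_trivial, ← h.variance_dotProduct]
    exact variance_nonneg _ _

end IsEpisodicSignal

end Moments

/-! ### The statistics as sums over the episodes -/

section Statistics

open scoped Kronecker

variable {Ω : Type*} {X : ℕ → Ω → ℝ} {T K n : ℕ}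

lemma sSimp_segment (hn : n = K * T) (ω : Ω) :
    sSimp n (segment X 0 n ω) =
      ∑ k ∈ Finset.range K, (fun _ => (1 : ℝ)) ⬝ᵥ segment X (k * T) T ω := by
  subst hn
  rw [sSimp, ← finProdFinEquiv.sum_comp, Fintype.sum_prod_type, Finset.sum_range]
  simp [dotProduct, segment, mul_comm, add_comm]

variable [NeZero T] (S : Matrix (Fin T) (Fin T) ℝ)

/-- The Kronecker form makes the inverse `1 ⊗ₖ S⁻¹`, so the weights `1ᵀ Σ⁻¹` repeat from episode to
episode. -/
lemma signalCov_mul : signalCov T S (K * T) =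
    ((1 : Matrix (Fin K) (Fin K) ℝ) ⊗ₖ S).submatrix finProdFinEquiv.symm finProdFinEquiv.symm := by
  refine Matrix.ext fun s t => ?_
  obtain ⟨⟨k, i⟩, rfl⟩ := finProdFinEquiv.surjective s
  obtain ⟨⟨l, j⟩, rfl⟩ := finProdFinEquiv.surjective t
  have hT : 0 < T := Nat.pos_of_neZero T
  have hdiv : ∀ (k : Fin K) (i : Fin T), ((i : ℕ) + T * k) / T = k := fun k i => by
    rw [Nat.add_mul_div_left _ _ hT, Nat.div_eq_of_lt i.2, zero_add]
  have hmod : ∀ (k : Fin K) (i : Fin T), Fin.ofNat T ((i : ℕ) + T * k) = i := fun k i =>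
    Fin.ext (by simp [Nat.mod_eq_of_lt i.2])
  simp only [signalCov, Matrix.of_apply, finProdFinEquiv_apply_val, hdiv, hmod,
    Matrix.submatrix_apply, Equiv.symm_apply_apply, Matrix.kronecker_apply, Matrix.one_apply,
    Fin.val_inj, ite_mul, one_mul, zero_mul]

lemma sUnif_segment (hn : n = K * T) (ω : Ω) :
    sUnif T S n (segment X 0 n ω) =
      ∑ k ∈ Finset.range K, ((fun _ => (1 : ℝ)) ᵥ* S⁻¹) ⬝ᵥ segment X (k * T) T ω := by
  subst hn
  rw [sUnif, signalCov_mul, Matrix.inv_submatrix_equiv, Matrix.inv_kronecker, inv_one,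
    Matrix.submatrix_vecMul_equiv, comp_equiv_symm_dotProduct, dotProduct, Fintype.sum_prod_type,
    Finset.sum_range]
  refine Finset.sum_congr rfl fun k _ => Finset.sum_congr rfl fun i _ => ?_
  congr 1
  · simp [Matrix.vecMul, dotProduct, Fintype.sum_prod_type, Matrix.one_apply]
  · simp [segment, mul_comm, add_comm]

end Statistics

/-! ### Asymptotic level and power of normalized linear statistics -/

section Asymptotics

variable {Ω : Type*} [MeasurableSpace Ω] {X : ℕ → Ω → ℝ} {T : ℕ} {P₀ : Measure Ω}
  {s : (n : ℕ) → (Fin n → ℝ) → ℝ} {w : Fin T → ℝ} {μ : Fin T → ℝ}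
  {S : Matrix (Fin T) (Fin T) ℝ}

/-- The length `n` is kept apart from `K * T` so that `hs` also applies to the single episode of
length `T` (not `1 * T`) in the centring; `0 * T` makes that episode the term `k = 0` of the i.i.d.
sequence. -/
lemma normalized_eq (hs : ∀ n K : ℕ, n = K * T → ∀ ω, s n (segment X 0 n ω) =
      ∑ k ∈ Finset.range K, w ⬝ᵥ segment X (k * T) T ω) (K : ℕ) (ω : Ω) :
    normalized s T X P₀ K ω =
      (∑ k ∈ Finset.range K, w ⬝ᵥ segment X (k * T) T ω -
        K * ∫ ω', w ⬝ᵥ segment X (0 * T) T ω' ∂P₀) /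
      √(K * variance (fun ω' => w ⬝ᵥ segment X (0 * T) T ω') P₀) := by
  have h1 : ∀ ω, s T (segment X 0 T ω) = w ⬝ᵥ segment X (0 * T) T ω := fun ω => by
    rw [hs T 1 (one_mul T).symm, Finset.sum_range_one]
  simp_rw [normalized, h1, hs _ K rfl]

variable [IsProbabilityMeasure P₀]

/-- Under the null hypothesis the level of the test tends to `α`. -/
lemma tendsto_measureReal_normalized_null (hT : 0 < T)
    (hs : ∀ n K : ℕ, n = K * T → ∀ ω, s n (segment X 0 n ω) =
      ∑ k ∈ Finset.range K, w ⬝ᵥ segment X (k * T) T ω)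
    (h₀ : ∀ K, 1 ≤ K → IsEpisodicSignal T (K * T) μ S X P₀) (hvar : 0 < w ⬝ᵥ S *ᵥ w)
    {α : ℝ} (hα : α ∈ Set.Ioo (0 : ℝ) 1) :
    Tendsto (fun K : ℕ => P₀.real {ω | normalized s T X P₀ K ω ≤ normalQuantile α})
      atTop (𝓝 α) := by
  simp_rw [normalized_eq hs]
  refine tendsto_measureReal_normalized_sum_le_quantile (iIndepFun_dotProduct_episodes hT h₀ w)
    (identDistrib_dotProduct_episodes hT h₀ w) ?_ ?_ hα
  · simpa only [zero_mul] using (h₀ 1 le_rfl).memLp_dotProduct w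
  · simpa only [zero_mul, (h₀ 1 le_rfl).variance_dotProduct w] using hvar

/-- If the mean of the statistic is lower than under the null hypothesis, then the power of the test
tends to `1`. -/
lemma tendsto_measureReal_normalized_alternative (hT : 0 < T)
    (hs : ∀ n K : ℕ, n = K * T → ∀ ω, s n (segment X 0 n ω) =
      ∑ k ∈ Finset.range K, w ⬝ᵥ segment X (k * T) T ω)
    (h₀ : ∀ K, 1 ≤ K → IsEpisodicSignal T (K * T) μ S X P₀) (hvar : 0 < w ⬝ᵥ S *ᵥ w)
    {P : Measure Ω} [IsProbabilityMeasure P]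
    {ν : Fin T → ℝ} (h : ∀ K, 1 ≤ K → IsEpisodicSignal T (K * T) ν S X P)
    (hν : w ⬝ᵥ ν < w ⬝ᵥ μ) (q : ℝ) :
    Tendsto (fun K : ℕ => P.real {ω | normalized s T X P₀ K ω ≤ q}) atTop (𝓝 1) := by
  simp_rw [normalized_eq hs]
  refine tendsto_measureReal_normalized_sum_le_one (fun k => ?_)
    (iIndepFun_dotProduct_episodes hT h w) (identDistrib_dotProduct_episodes hT h w) ?_ ?_ ?_ q
  · have := measurable_segment (measurable_of_forall_isEpisodicSignal hT h) (k * T) T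
    unfold dotProduct
    fun_prop
  · simpa only [zero_mul] using ((h 1 le_rfl).memLp_dotProduct w).integrable (by norm_num)
  · simpa only [zero_mul, (h₀ 1 le_rfl).integral_dotProduct w,
      (h 1 le_rfl).integral_dotProduct w] using hν
  · simpa only [zero_mul, (h₀ 1 le_rfl).variance_dotProduct w] using hvar

end Asymptotics

end Episodic

theorem mainTheorem5 {Ω : Type*} [MeasurableSpace Ω] (X : ℕ → Ω → ℝ)
    (T : ℕ) [NeZero T] (μ₀ : Fin T → ℝ) (S₀ : Matrix (Fin T) (Fin T) ℝ)
    (P₀ : Measure Ω) [IsProbabilityMeasure P₀] (hP₀ : Episodic.RollingNull T μ₀ S₀ X P₀)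
    (α : ℝ) (hα : α ∈ Set.Ioo (0 : ℝ) 1) :
    (Tendsto (fun K : ℕ => P₀.real
        {ω | Episodic.normalized Episodic.sSimp T X P₀ K ω ≤ Episodic.normalQuantile α})
        atTop (𝓝 α) ∧
      Tendsto (fun K : ℕ => P₀.real
        {ω | Episodic.normalized (Episodic.sUnif T S₀) T X P₀ K ω ≤ Episodic.normalQuantile α})
        atTop (𝓝 α)) ∧
    ∀ ε : ℝ, 0 < ε → ∀ (P : Measure Ω) [IsProbabilityMeasure P],
      Episodic.RollingUniformDegradation T μ₀ S₀ ε X P →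
        Tendsto (fun K : ℕ => P.real
          {ω | Episodic.normalized Episodic.sSimp T X P₀ K ω ≤ Episodic.normalQuantile α})
          atTop (𝓝 1) ∧
        Tendsto (fun K : ℕ => P.real
          {ω | Episodic.normalized (Episodic.sUnif T S₀) T X P₀ K ω ≤ Episodic.normalQuantile α})
          atTop (𝓝 1) := by
  have hT : 0 < T := Nat.pos_of_neZero T
  have h₀ : ∀ K, 1 ≤ K → Episodic.IsEpisodicSignal T (K * T) μ₀ S₀ X P₀ := fun K hK =>
    (hP₀ (K * T) (Nat.mul_pos hK hT)).1
  have hpos : S₀.PosDef := (h₀ 1 le_rfl).posDef (hP₀ 1 le_rfl).2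
  have hone : (fun _ : Fin T => (1 : ℝ)) ≠ 0 := fun h => one_ne_zero (congrFun h 0)
  have hquad : ∀ {w : Fin T → ℝ}, w ≠ 0 → 0 < w ⬝ᵥ S₀ *ᵥ w := fun hw => by
    simpa only [star_trivial] using hpos.dotProduct_mulVec_pos hw
  set u : Fin T → ℝ := (fun _ => (1 : ℝ)) ᵥ* S₀⁻¹ with hu
  -- `1ᵀ S₀⁻¹ 1 > 0`, as `S₀⁻¹` is positive definite; this is the loss of mean per episode and per
  -- unit of `ε`.
  have hu_one : 0 < u ⬝ᵥ fun _ => (1 : ℝ) := by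
    rw [hu, ← Matrix.dotProduct_mulVec]
    simpa only [star_trivial] using hpos.inv.dotProduct_mulVec_pos hone
  have hu_ne : u ≠ 0 := fun h => by simp [h] at hu_one
  have hone_one : 0 < (fun _ : Fin T => (1 : ℝ)) ⬝ᵥ fun _ => (1 : ℝ) := by
    simp [dotProduct, hT]
  have hsimp : ∀ n K : ℕ, n = K * T → ∀ ω, Episodic.sSimp n (Episodic.segment X 0 n ω) =
      ∑ k ∈ Finset.range K, (fun _ => (1 : ℝ)) ⬝ᵥ Episodic.segment X (k * T) T ω :=
    fun _ _ hn ω => Episodic.sSimp_segment hn ω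
  have hunif : ∀ n K : ℕ, n = K * T → ∀ ω, Episodic.sUnif T S₀ n (Episodic.segment X 0 n ω) =
      ∑ k ∈ Finset.range K, u ⬝ᵥ Episodic.segment X (k * T) T ω :=
    fun _ _ hn ω => Episodic.sUnif_segment S₀ hn ω
  refine ⟨⟨Episodic.tendsto_measureReal_normalized_null hT hsimp h₀ (hquad hone) hα,
    Episodic.tendsto_measureReal_normalized_null hT hunif h₀ (hquad hu_ne) hα⟩,
    fun ε hε P _ hP => ?_⟩
  have h : ∀ K, 1 ≤ K → Episodic.IsEpisodicSignal T (K * T) (μ₀ - fun _ => ε) S₀ X P :=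
    fun K hK => by
      obtain ⟨_, rfl, hK'⟩ := hP K hK
      exact hK'
  have hmean : ∀ w : Fin T → ℝ, 0 < w ⬝ᵥ (fun _ => (1 : ℝ)) →
      w ⬝ᵥ (μ₀ - fun _ => ε) < w ⬝ᵥ μ₀ := fun w hw => by
    have hε_eq : (fun _ : Fin T => ε) = ε • fun _ => (1 : ℝ) := by ext; simp
    rw [dotProduct_sub, hε_eq, dotProduct_smul, smul_eq_mul]
    linarith [mul_pos hε hw]
  exact ⟨Episodic.tendsto_measureReal_normalized_alternative hT hsimp h₀ (hquad hone) h
      (hmean _ hone_one) _,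
    Episodic.tendsto_measureReal_normalized_alternative hT hunif h₀ (hquad hu_ne) h
      (hmean _ hu_one) _⟩
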